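/- **Setting.** A graph $G=(V,E)$ consists of a finite set $V$ and a multiset $E$ of ordered pairs of elements of $V$ (loops and repeated edges allowed); $b:V\to\mathbb R_{\ge0}$ is a node weight function. Let $\Gamma^+_v(G)$ and $\Gamma^-_v(G)$ be the multisets of outgoing and incoming edges of $v$, let $\deg^+_v(G)=|\Gamma^+_v(G)|$, and let $\#_{(u,v)}(G)$ be the number of edges from $u$ to $v$. Let $dist_{u,v}(G)$ be the least number of edges (at least one) of a path from $u$ to $v$, and $\infty$ if there is no such path. The graph is strongly connected if $V\neq\emptyset$ and for all $u,v\in V$, including $u=v$, there is a path with at least one edge from $u$ to $v$; $\mathcal{SCG}$ is the class of these graphs. Let $A(G)$ be the matrix with entries $A_{v,u}=\#_{(u,v)}(G)$, and let $\lambda(G)$ be its largest real eigenvalue ($\lambda(G)=0$ if $V=\emptyset$). For $a\in(0,1)$ let $\mathcal{KG}^a$ be the class of graphs with $\lambda(G)<1/a$. **Centralities.** On all graphs: - degree centrality: $D_v(G,b)=|\Gamma^-_v(G)|$; - beta measure: $\beta_v(G,b)=\sum_{(u,v)\in\Gamma^-_v(G)}1/\deg^+_u(G)$; - decay centrality, for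 $a\in(0,1)$: $Y^a_v(G,b)=\sum_{u\ne v}a^{dist_{u,v}(G)}$, with $a^\infty=0$; - betweenness centrality: $B_v(G,b)=\sum \sigma_{st}(v)/\sigma_{st}$, summed over ordered pairs of distinct $s,t\in V\setminus\{v\}$ with $\sigma_{st}\ne0$, where $\sigma_{st}$ is the number of shortest paths from $s$ to $t$ (parallel edges give different paths) and $\sigma_{st}(v)$ is the number of those that go through $v$. On $\mathcal{SCG}$: - closeness centrality: $C_v(G,b)=1/\sum_{u\ne v}dist_{u,v}(G)$; - eigenvector centrality: the solution $x$ of $x_v=\frac1{\lambda(G)}\sum_{(u,v)\in\Gamma^-_v(G)}x_u$ $(v\in V)$ with $\sum_v x_v=1$; - Katz prestige: the solution $x$ of $x_v=\sum_{(u,v)\in\Gamma^-_v(G)}x_u/\deg^+_u(G)$ $(v\in V)$ with $\sum_v x_v=1$. On $\mathcal{KG}^a$, for $a\in(0,1)$: - Katz centrality: the solution $x$ of $x_v=a\sum_{(u,v)\in\Gamma^-_v(G)}x_u+b(v)$ $(v\in V)$; - Bonacich centrality: the solution $x$ of $x_v=\sum_{(u,v)\in\Gamma^-_v(G)}(a\,x_u+b(u))$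 $(v\in V)$. **Edge Swap on a class $\mathcal G$**, for a centrality $F$: for every graph $G=(V,E)\in\mathcal G$, node weights $b$, and two edges $(u,u'),(w,w')$ of $G$ (that is, $\{\!|(u,u'),(w,w')|\!\}\subseteq E$ as multisets) with $F_u(G,b)=F_w(G,b)$ and $\deg^+_u(G)=\deg^+_w(G)$, if $G'=(V,\,E-\{\!|(u,u'),(w,w')|\!\}\sqcup\{\!|(u,w'),(w,u')|\!\})\in\mathcal G$, then $F_v(G,b)=F_v(G',b)$ for every $v\in V$. **Proposition (Edge Swap).** 1. The four systems of equations above have exactly one solution on every weighted graph of the stated class, and it is non-negative. 2. Edge Swap is satisfied by degree centrality and beta measure (on all graphs), by eigenvector centrality and Katz prestige (on $\mathcal{SCG}$), and by Katz centrality (on $\mathcal{KG}^a$, for every $a\in(0,1)$). 3. Edge Swap is not satisfied by Bonacich centrality (on $\mathcal{KG}^a$, for every $a\in(0,1)$), closeness centrality (on $\mathcal{SCG}$), decay centrality (on all graphs, for every $a\in(0,1)$) and betweenness centrality (on all graphs). 4. If $G\in\mathcal{SCG}$ and $A(G)x=cx$ with $c\in\mathbb R$ and $x_v>0$ for all $v$,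 then $c=\lambda(G)$. In particular, whenever $G,G'\in\mathcal{SCG}$ are as in Edge Swap for eigenvector centrality, $\lambda(G)=\lambda(G')$. -/

import Mathlib

open scoped NNReal Matrix

universe u

/-- A finite directed multigraph on the node set `V`: a multiset of ordered pairs of nodes.
Loops and repeated edges are allowed. -/
structure DirMultigraph (V : Type u) where
  edges : Multiset (V × V)

namespace DirMultigraph

section Basic

variable {V : Type u} [DecidableEq V]

/-- The multiset of outgoing edges of `v`. -/
def outEdges (G : DirMultigraph V) (v : V) : Multiset (V × V) :=
  G.edges.filter fun e => e.1 = v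

/-- The multiset of incoming edges of `v`. -/
def inEdges (G : DirMultigraph V) (v : V) : Multiset (V × V) :=
  G.edges.filter fun e => e.2 = v

/-- The out-degree of `v`, with multiplicity. -/
def outDegree (G : DirMultigraph V) (v : V) : ℕ :=
  (G.outEdges v).card

/-- The number of edges from `u` to `v`. -/
def mult (G : DirMultigraph V) (u v : V) : ℕ :=
  G.edges.count (u, v)

/-- Swapping the ends of the edges `(u, u')` and `(w, w')`. -/
def swap (G : DirMultigraph V) (u u' w w' : V) : DirMultigraph V :=
  ⟨G.edges - {(u, u'), (w, w')} + {(u, w'), (w, u')}⟩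

/-- There is a path with `n` edges from `u` to `v`. -/
def HasPath (G : DirMultigraph V) (n : ℕ) (u v : V) : Prop :=
  ∃ p : Fin (n + 1) → V, p 0 = u ∧ p (Fin.last n) = v ∧
    ∀ i : Fin n, (p i.castSucc, p i.succ) ∈ G.edges

/-- `v` is a successor of `u`: there is a path with at least one edge from `u` to `v`. -/
def IsSuccessor (G : DirMultigraph V) (u v : V) : Prop :=
  ∃ n : ℕ, 1 ≤ n ∧ G.HasPath n u v

/-- The distance from `u` to `v`: the least length of a path with at least one edge
from `u` to `v`, and `⊤` if there is no such path. -/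
noncomputable def dist (G : DirMultigraph V) (u v : V) : ℕ∞ :=
  sInf {d : ℕ∞ | ∃ n : ℕ, 1 ≤ n ∧ G.HasPath n u v ∧ d = (n : ℕ∞)}

variable [Fintype V]

/-- Strongly connected: the graph has a node, and every node is a successor of every node
(itself included, so an isolated node is not a strongly connected graph). -/
def StronglyConnected (G : DirMultigraph V) : Prop :=
  Nonempty V ∧ ∀ u v : V, G.IsSuccessor u v

/-- The adjacency matrix with `(v, u)` entry the number of edges from `u` to `v`. -/
def adjMatrix (G : DirMultigraph V) : Matrix V V ℝ :=
  Matrix.of fun v u => (G.mult u v : ℝ)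

/-- The largest real eigenvalue of the adjacency matrix. -/
noncomputable def lam (G : DirMultigraph V) : ℝ :=
  sSup {c : ℝ | ∃ x : V → ℝ, x ≠ 0 ∧ G.adjMatrix *ᵥ x = c • x}

/-- The number of paths with `n` edges from `s` to `t`; parallel edges give different paths, so
a node sequence is counted with the product of the multiplicities of its steps. -/
def numPaths (G : DirMultigraph V) (n : ℕ) (s t : V) : ℕ :=
  ∑ p : Fin (n + 1) → V, if p 0 = s ∧ p (Fin.last n) = t then
    ∏ i : Fin n, G.mult (p i.castSucc) (p i.succ) else 0

/-- The number of those paths with `n` edges from `s` to `t` that go through `v`. -/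
def numPathsThrough (G : DirMultigraph V) (n : ℕ) (s t v : V) : ℕ :=
  ∑ p : Fin (n + 1) → V, if p 0 = s ∧ p (Fin.last n) = t ∧ ∃ i, p i = v then
    ∏ i : Fin n, G.mult (p i.castSucc) (p i.succ) else 0

open Classical in
/-- The number of shortest paths from `s` to `t`. -/
noncomputable def numShortestPaths (G : DirMultigraph V) (s t : V) : ℕ :=
  if G.dist s t = ⊤ then 0 else G.numPaths (G.dist s t).toNat s t

open Classical in
/-- The number of shortest paths from `s` to `t` that go through `v`. -/
noncomputable def numShortestPathsThrough (G : DirMultigraph V) (s t v : V) : ℕ :=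
  if G.dist s t = ⊤ then 0 else G.numPathsThrough (G.dist s t).toNat s t v

end Basic

/-- A class of finite graphs. -/
abbrev GraphClass : Type (u + 1) :=
  ∀ (V : Type u) [Fintype V] [DecidableEq V], DirMultigraph V → Prop

/-- A real-valued function of graphs, non-negative node weights and nodes. -/
abbrev Centrality : Type (u + 1) :=
  ∀ (V : Type u) [Fintype V] [DecidableEq V], DirMultigraph V → (V → ℝ≥0) → V → ℝ

/-- A condition (system of equations) on a vector `x`, for every weighted graph. -/
abbrev CentralitySystem : Type (u + 1) :=
  ∀ (V : Type u) [Fintype V] [DecidableEq V], DirMultigraph V → (V → ℝ≥0) → (V → ℝ) → Prop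

/-- All graphs. -/
def allGraphs : GraphClass.{u} := fun _ _ _ _ => True

/-- Strongly connected graphs. -/
def scGraphs : GraphClass.{u} := fun _ _ _ G => G.StronglyConnected

/-- Graphs whose largest eigenvalue is less than `1 / a`. -/
def katzGraphs (a : ℝ) : GraphClass.{u} := fun _ _ _ G => G.lam < 1 / a

/-- The system has, on every weighted graph of the class, exactly one solution, and this
solution is non-negative. -/
def DefinesCentralityOn (C : GraphClass.{u}) (S : CentralitySystem.{u}) : Prop :=
  ∀ (V : Type u) [Fintype V] [DecidableEq V] (G : DirMultigraph V) (b : V → ℝ≥0),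
    C V G → (∃! x : V → ℝ, S V G b x) ∧ ∀ x : V → ℝ, S V G b x → ∀ v, 0 ≤ x v

/-- The centrality whose values are the solution of the system. -/
noncomputable def CentralitySystem.solution (S : CentralitySystem.{u}) : Centrality.{u} :=
  fun V _ _ G b => Classical.epsilon fun x : V → ℝ => S V G b x

/-- Edge Swap restricted to the class `C`. The multiset inequality says that `(u, u')` and
`(w, w')` are two edges of the graph (two copies of one edge if they are equal as pairs). -/
def EdgeSwapOn (C : GraphClass.{u}) (F : Centrality.{u}) : Prop :=
  ∀ (V : Type u) [Fintype V] [DecidableEq V] (G : DirMultigraph V) (b : V → ℝ≥0)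
    (u u' w w' : V),
    C V G → ({(u, u'), (w, w')} : Multiset (V × V)) ≤ G.edges →
    F V G b u = F V G b w → G.outDegree u = G.outDegree w →
    C V (G.swap u u' w w') →
    ∀ v : V, F V G b v = F V (G.swap u u' w w') b v

/-- Degree centrality. -/
def degreeCentrality : Centrality.{u} := fun _ _ _ G _ v =>
  ((G.inEdges v).card : ℝ)

/-- Beta measure. -/
noncomputable def betaMeasure : Centrality.{u} := fun _ _ _ G _ v =>
  ((G.inEdges v).map fun e => 1 / (G.outDegree e.1 : ℝ)).sum

/-- Eigenvector equations, normalized to total `1`. -/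
def eigenvectorSystem : CentralitySystem.{u} := fun _ _ _ G _ x =>
  (∀ v, x v = 1 / G.lam * ((G.inEdges v).map fun e => x e.1).sum) ∧ ∑ v, x v = 1

/-- Katz prestige equations, normalized to total `1`. -/
def katzPrestigeSystem : CentralitySystem.{u} := fun _ _ _ G _ x =>
  (∀ v, x v = ((G.inEdges v).map fun e => x e.1 / (G.outDegree e.1 : ℝ)).sum) ∧ ∑ v, x v = 1

/-- Katz equations with decay factor `a`. -/
def katzSystem (a : ℝ) : CentralitySystem.{u} := fun _ _ _ G b x =>
  ∀ v, x v = a * ((G.inEdges v).map fun e => x e.1).sum + (b v : ℝ)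

/-- Bonacich equations with decay factor `a`. -/
def bonacichSystem (a : ℝ) : CentralitySystem.{u} := fun _ _ _ G b x =>
  ∀ v, x v = ((G.inEdges v).map fun e => a * x e.1 + (b e.1 : ℝ)).sum

/-- Eigenvector centrality. -/
noncomputable def eigenvectorCentrality : Centrality.{u} := eigenvectorSystem.solution

/-- Katz prestige. -/
noncomputable def katzPrestige : Centrality.{u} := katzPrestigeSystem.solution

/-- Katz centrality. -/
noncomputable def katzCentrality (a : ℝ) : Centrality.{u} := (katzSystem a).solution

/-- Bonacich centrality. -/
noncomputable def bonacichCentrality (a : ℝ) : Centrality.{u} := (bonacichSystem a).solution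

/-- Closeness centrality. -/
noncomputable def closenessCentrality : Centrality.{u} := fun _ _ _ G _ v =>
  1 / ∑ u ∈ Finset.univ.erase v, ((G.dist u v).toNat : ℝ)

open Classical in
/-- Decay centrality with decay factor `a`; unreachable pairs contribute `0`. -/
noncomputable def decayCentrality (a : ℝ) : Centrality.{u} := fun _ _ _ G _ v =>
  ∑ u ∈ Finset.univ.erase v, if G.dist u v = ⊤ then 0 else a ^ (G.dist u v).toNat

/-- Betweenness centrality: sum over ordered pairs of distinct nodes different from `v`. -/
noncomputable def betweennessCentrality : Centrality.{u} := fun _ _ _ G _ v =>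
  ∑ s ∈ Finset.univ.erase v, ∑ t ∈ (Finset.univ.erase v).erase s,
    if G.numShortestPaths s t ≠ 0 then
      (G.numShortestPathsThrough s t v : ℝ) / (G.numShortestPaths s t : ℝ)
    else 0

end DirMultigraph

/-!
For a matrix `A` with nonnegative entries, let `ρ` be the infimum of the `s` for which some positive
`y` satisfies `A y < s y`. For `s > ρ`, comparing `x` with multiples of such a `y` gives a minimum
principle: `A x ≤ s x` forces `0 ≤ x`. So `(s - A) x = f` has exactly one solution, which is
nonnegative when `f` is; this settles the Katz and Bonacich equations. Letting `s` tend to `ρ` in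
the normalized solutions for constant `f` yields a nonnegative eigenvector for `ρ`, the largest
eigenvalue. If `A` is irreducible, a nonnegative eigenvector is positive, hence itself certifies
that its eigenvalue is `ρ`; subtracting multiples until a coordinate vanishes shows uniqueness up to
scaling. This settles the eigenvector and Katz prestige equations.

Swapping the heads of two edges whose tails carry the same value and out-degree changes no sum over
incoming edges. Hence the old solution solves the new equations as well; for eigenvector centrality
it is a positive eigenvector of the new adjacency matrix, so `λ` does not change either.
-/

namespace PerronFrobenius

lemma pow_mulVec_eq_smul {ι R : Type*} [CommSemiring R] [Fintype ι] [DecidableEq ι]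
    {A : Matrix ι ι R} {r : R} {y : ι → R} (hr : A *ᵥ y = r • y) (k : ℕ) :
    A ^ k *ᵥ y = r ^ k • y := by
  induction k with
  | zero => simp
  | succ k ih => rw [pow_succ, ← Matrix.mulVec_mulVec, hr, Matrix.mulVec_smul, ih, smul_smul,
      pow_succ']

section OrderedField

variable {ι K : Type*} [Field K] [LinearOrder K] [IsStrictOrderedRing K]

lemma exists_smul_le_and_eq [Finite ι] [Nonempty ι] {x : ι → K} (hx : ∀ i, 0 < x i) (y : ι → K) :
    ∃ m i, m • x ≤ y ∧ m * x i = y i := by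
  obtain ⟨i, hi⟩ := Finite.exists_min fun i => y i / x i
  exact ⟨y i / x i, i, fun j => (le_div_iff₀ (hx j)).1 (hi j), div_mul_cancel₀ _ (hx i).ne'⟩

variable [Fintype ι] {A : Matrix ι ι K} {r s : K} {x y : ι → K}

/-- `A` contracts some positive vector strictly by the factor `s`. For a nonnegative matrix this
certifies that `s` exceeds every eigenvalue and that the inverse of `s - A` exists and is
nonnegative. -/
def HasStrictSupersolution (A : Matrix ι ι K) (s : K) : Prop :=
  ∃ x : ι → K, (∀ i, 0 < x i) ∧ ∀ i, (A *ᵥ x) i < s * x i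

namespace HasStrictSupersolution

lemma mono {t : K} (h : HasStrictSupersolution A s) (hst : s ≤ t) :
    HasStrictSupersolution A t := by
  obtain ⟨x, hx, hs⟩ := h
  exact ⟨x, hx, fun i => (hs i).trans_le (mul_le_mul_of_nonneg_right hst (hx i).le)⟩

lemma exists_lt (h : HasStrictSupersolution A s) : ∃ t < s, HasStrictSupersolution A t := by
  obtain ⟨x, hx, hs⟩ := h
  cases isEmpty_or_nonempty ι with
  | inl hι => exact ⟨s - 1, sub_one_lt s, x, hx, hι.elim⟩
  | inr hι =>
    obtain ⟨m, i, hle, heq⟩ := exists_smul_le_and_eq hx (s • x - A *ᵥ x)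
    have hm : 0 < m := pos_of_mul_pos_left (heq ▸ sub_pos.2 (hs i)) (hx i).le
    refine ⟨s - m / 2, sub_lt_self s (half_pos hm), x, hx, fun j => ?_⟩
    have hj : m * x j ≤ s * x j - (A *ᵥ x) j := hle j
    linarith [mul_pos hm (hx j)]

lemma pos [Nonempty ι] (hA : ∀ i j, 0 ≤ A i j) (h : HasStrictSupersolution A s) : 0 < s := by
  obtain ⟨x, hx, hs⟩ := h
  let i : ι := Classical.arbitrary ι
  have hAx : 0 ≤ (A *ᵥ x) i := dotProduct_nonneg_of_nonneg (hA i) fun j => (hx j).le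
  exact pos_of_mul_pos_left (hAx.trans_lt (hs i)) (hx i).le

theorem minimum_principle (hA : ∀ i j, 0 ≤ A i j) (h : HasStrictSupersolution A s)
    (hy : A *ᵥ y ≤ s • y) : 0 ≤ y := by
  obtain ⟨x, hx, hs⟩ := h
  cases isEmpty_or_nonempty ι with
  | inl hι => exact hι.elim
  | inr hι =>
    obtain ⟨m, i, hle, heq⟩ := exists_smul_le_and_eq hx y
    suffices hm : 0 ≤ m from fun j => (mul_nonneg hm (hx j).le).trans (hle j)
    by_contra! hm
    have hAx : m * (A *ᵥ x) i ≤ m * (s * x i) :=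
      calc m * (A *ᵥ x) i = (A *ᵥ (m • x)) i := by rw [Matrix.mulVec_smul]; rfl
        _ ≤ (A *ᵥ y) i := dotProduct_le_dotProduct_of_nonneg_left hle (hA i)
        _ ≤ s * y i := hy i
        _ = m * (s * x i) := by rw [← heq, mul_left_comm]
    exact hAx.not_gt (mul_lt_mul_of_neg_left (hs i) hm)

lemma eq_zero_of_mulVec_eq_smul (hA : ∀ i j, 0 ≤ A i j) (h : HasStrictSupersolution A s)
    (hy : A *ᵥ y = s • y) : y = 0 := by
  refine le_antisymm (neg_nonneg.1 (h.minimum_principle hA ?_)) (h.minimum_principle hA hy.le)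
  rw [Matrix.mulVec_neg, hy, smul_neg]

theorem existsUnique_smul_eq_mulVec_add (hA : ∀ i j, 0 ≤ A i j) (h : HasStrictSupersolution A s)
    (b : ι → K) : ∃! y : ι → K, s • y = A *ᵥ y + b := by
  let f : (ι → K) →ₗ[K] (ι → K) := s • LinearMap.id - A.mulVecLin
  have hf (y) : f y = b ↔ s • y = A *ᵥ y + b := sub_eq_iff_eq_add'
  have hinj : Function.Injective f := LinearMap.ker_eq_bot.1 <| LinearMap.ker_eq_bot'.2
    fun y hy => h.eq_zero_of_mulVec_eq_smul hA (sub_eq_zero.1 hy).symm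
  simp only [← hf]
  exact Function.Bijective.existsUnique ⟨hinj, LinearMap.injective_iff_surjective.1 hinj⟩ b

end HasStrictSupersolution

lemma exists_hasStrictSupersolution (A : Matrix ι ι K) : ∃ s, HasStrictSupersolution A s := by
  obtain ⟨M, hM⟩ := (Set.finite_range (A *ᵥ 1)).bddAbove
  refine ⟨M + 1, 1, fun _ => one_pos, fun i => ?_⟩
  rw [Pi.one_apply, mul_one]
  exact (hM (Set.mem_range_self i)).trans_lt (lt_add_one M)

theorem pos_of_isIrreducible (hA : A.IsIrreducible) (hy : 0 ≤ y) (hy0 : y ≠ 0)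
    (hr : A *ᵥ y = r • y) : 0 < r ∧ ∀ i, 0 < y i := by
  classical
  obtain ⟨j, hj⟩ := Function.ne_iff.1 hy0
  have hj : 0 < y j := (hy j).lt_of_ne' hj
  have hr0 : 0 ≤ r := by
    refine nonneg_of_mul_nonneg_left (b := y j) ?_ hj
    exact (dotProduct_nonneg_of_nonneg (hA.nonneg j) hy).trans_eq (congrFun hr j)
  have hpow (i) : ∃ k > 0, 0 < r ^ k * y i := by
    obtain ⟨k, hk, hkij⟩ := (Matrix.isIrreducible_iff_exists_pow_pos hA.nonneg).1 hA i j
    refine ⟨k, hk, ?_⟩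
    calc 0 < (A ^ k) i j * y j := mul_pos hkij hj
      _ ≤ (A ^ k *ᵥ y) i := Finset.single_le_sum (f := fun j => (A ^ k) i j * y j)
          (fun l _ => mul_nonneg (Matrix.pow_apply_nonneg hA.nonneg k i l) (hy l))
          (Finset.mem_univ j)
      _ = r ^ k * y i := congrFun (pow_mulVec_eq_smul hr k) i
  refine ⟨hr0.lt_of_ne' ?_, fun i => ?_⟩
  · rintro rfl
    obtain ⟨k, hk, hkj⟩ := hpow j
    simp [hk.ne'] at hkj
  · obtain ⟨k, -, hki⟩ := hpow i
    exact pos_of_mul_pos_right hki (pow_nonneg hr0 k)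

theorem exists_eq_smul_of_isIrreducible (hA : A.IsIrreducible) (hy : ∀ i, 0 < y i)
    (hr : A *ᵥ y = r • y) (hx : A *ᵥ x = r • x) : ∃ m : K, x = m • y := by
  cases isEmpty_or_nonempty ι with
  | inl hι => exact ⟨0, Subsingleton.elim _ _⟩
  | inr hι =>
    obtain ⟨m, i, hle, heq⟩ := exists_smul_le_and_eq hy x
    refine ⟨m, sub_eq_zero.1 (by_contra fun hne => ?_)⟩
    have heig : A *ᵥ (x - m • y) = r • (x - m • y) := by
      rw [Matrix.mulVec_sub, Matrix.mulVec_smul, hr, hx, smul_sub, smul_comm]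
    have hi : 0 < x i - m * y i :=
      (pos_of_isIrreducible hA (sub_nonneg.2 hle) hne heig).2 i
    exact hi.ne' (sub_eq_zero.2 heq.symm)

end OrderedField

section Real

variable {ι : Type*} [Fintype ι] {A : Matrix ι ι ℝ} {c s : ℝ} {x : ι → ℝ}

/-- The Perron root of a nonnegative matrix, given by the Collatz–Wielandt formula as the infimum
of the factors by which the matrix contracts some positive vector. It has the junk value `0` for
a matrix without rows. -/
noncomputable def perronRoot (A : Matrix ι ι ℝ) : ℝ :=
  sInf {s | HasStrictSupersolution A s}

lemma perronRoot_of_isEmpty [IsEmpty ι] (A : Matrix ι ι ℝ) : perronRoot A = 0 := by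
  have huniv : {s | HasStrictSupersolution A s} = Set.univ :=
    Set.eq_univ_of_forall fun _ => ⟨0, isEmptyElim, isEmptyElim⟩
  rw [perronRoot, huniv, Real.sInf_univ]

lemma hasStrictSupersolution_of_perronRoot_lt (h : perronRoot A < s) :
    HasStrictSupersolution A s := by
  obtain ⟨t, ht, hts⟩ := exists_lt_of_csInf_lt (exists_hasStrictSupersolution A) h
  exact HasStrictSupersolution.mono ht hts.le

lemma HasStrictSupersolution.perronRoot_lt [Nonempty ι] (hA : ∀ i j, 0 ≤ A i j)
    (h : HasStrictSupersolution A s) : perronRoot A < s := by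
  obtain ⟨t, hts, ht⟩ := h.exists_lt
  exact (csInf_le ⟨0, fun _ hs => (HasStrictSupersolution.pos hA hs).le⟩ ht).trans_lt hts

lemma perronRoot_nonneg [Nonempty ι] (hA : ∀ i j, 0 ≤ A i j) : 0 ≤ perronRoot A :=
  Real.sInf_nonneg fun _ hs => (HasStrictSupersolution.pos hA hs).le

lemma le_perronRoot_of_mulVec_eq_smul (hA : ∀ i j, 0 ≤ A i j) (hx : x ≠ 0)
    (hc : A *ᵥ x = c • x) : c ≤ perronRoot A := by
  by_contra! h
  exact hx ((hasStrictSupersolution_of_perronRoot_lt h).eq_zero_of_mulVec_eq_smul hA hc)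

lemma HasStrictSupersolution.exists_smul_eq_mulVec_add_const [Nonempty ι] (hA : ∀ i j, 0 ≤ A i j)
    (h : HasStrictSupersolution A s) :
    ∃ y ∈ stdSimplex ℝ ι, ∃ τ, 0 ≤ τ ∧ s • y = A *ᵥ y + fun _ => τ := by
  obtain ⟨x, hx, -⟩ := h.existsUnique_smul_eq_mulVec_add hA fun _ => 1
  have hx0 : 0 ≤ x := h.minimum_principle hA (hx ▸ le_add_of_nonneg_right fun _ => zero_le_one)
  have hsum : 0 < ∑ i, x i := by
    refine (Finset.sum_nonneg fun i _ => hx0 i).lt_of_ne' fun hzero => ?_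
    obtain rfl : x = 0 := (Fintype.sum_eq_zero_iff_of_nonneg hx0).1 hzero
    simpa using congrFun hx (Classical.arbitrary ι)
  refine ⟨(∑ i, x i)⁻¹ • x, ⟨fun i => mul_nonneg (inv_pos.2 hsum).le (hx0 i), ?_⟩,
    (∑ i, x i)⁻¹, (inv_pos.2 hsum).le, ?_⟩
  · simp only [Pi.smul_apply, smul_eq_mul, ← Finset.mul_sum, inv_mul_cancel₀ hsum.ne']
  · rw [smul_comm, hx, smul_add, Matrix.mulVec_smul]
    simp only [Pi.smul_def, smul_eq_mul, mul_one]

lemma isClosed_setOf_exists_mem_stdSimplex_smul_eq_mulVec_add_const [Nonempty ι]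
    (A : Matrix ι ι ℝ) :
    IsClosed {s : ℝ | ∃ y ∈ stdSimplex ℝ ι, ∃ τ, 0 ≤ τ ∧ s • y = A *ᵥ y + fun _ => τ} := by
  let i₀ : ι := Classical.arbitrary ι
  let τ (p : stdSimplex ℝ ι × ℝ) : ℝ := p.2 * p.1.1 i₀ - (A *ᵥ p.1.1) i₀
  have hval : Continuous fun p : stdSimplex ℝ ι × ℝ => p.1.1 :=
    continuous_subtype_val.comp continuous_fst
  have hAval : Continuous fun p : stdSimplex ℝ ι × ℝ => A *ᵥ p.1.1 :=
    continuous_const.matrix_mulVec hval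
  have hτ : Continuous τ := (continuous_snd.mul (continuous_pi_iff.1 hval i₀)).sub
    (continuous_pi_iff.1 hAval i₀)
  have hclosed : IsClosed {p | 0 ≤ τ p ∧ p.2 • p.1.1 = A *ᵥ p.1.1 + fun _ => τ p} :=
    (isClosed_le continuous_const hτ).inter <|
      isClosed_eq (continuous_snd.smul hval) (hAval.add (continuous_pi fun _ => hτ))
  have : CompactSpace (stdSimplex ℝ ι) := isCompact_iff_compactSpace.1 (isCompact_stdSimplex ℝ ι)
  convert isClosedMap_snd_of_compactSpace _ hclosed using 1
  ext s
  constructor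
  · rintro ⟨y, hy, t, ht, h⟩
    obtain rfl : t = τ (⟨y, hy⟩, s) := eq_sub_of_add_eq' (congrFun h i₀).symm
    exact ⟨(⟨y, hy⟩, s), ⟨ht, h⟩, rfl⟩
  · rintro ⟨⟨y, s⟩, ⟨ht, h⟩, rfl⟩
    exact ⟨y, y.2, _, ht, h⟩

lemma ne_zero_of_mem_stdSimplex {y : ι → ℝ} (hy : y ∈ stdSimplex ℝ ι) : y ≠ 0 := by
  rintro rfl
  simpa using hy.2

theorem exists_mem_stdSimplex_mulVec_eq_perronRoot_smul [Nonempty ι] (hA : ∀ i j, 0 ≤ A i j) :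
    ∃ y ∈ stdSimplex ℝ ι, A *ᵥ y = perronRoot A • y := by
  obtain ⟨y, hy, τ, hτ0, hτ⟩ :
      perronRoot A ∈ {s : ℝ | ∃ y ∈ stdSimplex ℝ ι, ∃ τ, 0 ≤ τ ∧ s • y = A *ᵥ y + fun _ => τ} := by
    have hIoi : Set.Ioi (perronRoot A) ⊆ _ := fun s (hs : perronRoot A < s) =>
      (hasStrictSupersolution_of_perronRoot_lt hs).exists_smul_eq_mulVec_add_const hA
    refine closure_minimal hIoi
      (isClosed_setOf_exists_mem_stdSimplex_smul_eq_mulVec_add_const A) ?_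
    rw [closure_Ioi]
    exact Set.self_mem_Ici
  have hτi (i) : perronRoot A * y i = (A *ᵥ y) i + τ := congrFun hτ i
  rcases hτ0.eq_or_lt with rfl | hτpos
  · exact ⟨y, hy, funext fun i => by simpa using (hτi i).symm⟩
  -- A positive `τ` would make `y` a strict supersolution at the infimum itself.
  have hpos (i) : 0 < y i := by
    refine pos_of_mul_pos_right (a := perronRoot A) ?_ (perronRoot_nonneg hA)
    rw [hτi]
    exact add_pos_of_nonneg_of_pos (dotProduct_nonneg_of_nonneg (hA i) hy.1) hτpos
  have hsuper : HasStrictSupersolution A (perronRoot A) :=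
    ⟨y, hpos, fun i => (lt_add_of_pos_right _ hτpos).trans_eq (hτi i).symm⟩
  exact ((hsuper.perronRoot_lt hA).false).elim

theorem isGreatest_perronRoot [Nonempty ι] (hA : ∀ i j, 0 ≤ A i j) :
    IsGreatest {c : ℝ | ∃ x : ι → ℝ, x ≠ 0 ∧ A *ᵥ x = c • x} (perronRoot A) := by
  refine ⟨?_, fun c ⟨x, hx, hc⟩ => le_perronRoot_of_mulVec_eq_smul hA hx hc⟩
  obtain ⟨y, hy, heig⟩ := exists_mem_stdSimplex_mulVec_eq_perronRoot_smul hA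
  exact ⟨y, ne_zero_of_mem_stdSimplex hy, heig⟩

theorem perronRoot_eq_of_isIrreducible (hA : A.IsIrreducible) (hx : 0 ≤ x) (hx0 : x ≠ 0)
    (hc : A *ᵥ x = c • x) : perronRoot A = c := by
  obtain ⟨i, -⟩ := Function.ne_iff.1 hx0
  have : Nonempty ι := ⟨i⟩
  have hxpos := (pos_of_isIrreducible hA hx hx0 hc).2
  refine le_antisymm (le_of_forall_gt fun s hs => ?_)
    (le_perronRoot_of_mulVec_eq_smul hA.nonneg hx0 hc)
  refine HasStrictSupersolution.perronRoot_lt hA.nonneg ⟨x, hxpos, fun i => ?_⟩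
  rw [hc]
  exact mul_lt_mul_of_pos_right hs (hxpos i)

theorem exists_pos_forall_iff_eq_of_isIrreducible [Nonempty ι] (hA : A.IsIrreducible) :
    ∃ y : ι → ℝ, (∀ i, 0 < y i) ∧ ∀ x, A *ᵥ x = perronRoot A • x ∧ ∑ i, x i = 1 ↔ x = y := by
  obtain ⟨y, hysimplex, hy⟩ := exists_mem_stdSimplex_mulVec_eq_perronRoot_smul hA.nonneg
  have hypos :=
    (pos_of_isIrreducible hA hysimplex.1 (ne_zero_of_mem_stdSimplex hysimplex) hy).2
  refine ⟨y, hypos, fun x => ⟨fun ⟨hx, hxsum⟩ => ?_, ?_⟩⟩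
  · obtain ⟨m, rfl⟩ := exists_eq_smul_of_isIrreducible hA hypos hy hx
    obtain rfl : m = 1 := by simpa [← Finset.mul_sum, hysimplex.2] using hxsum
    exact one_smul ℝ y
  · rintro rfl
    exact ⟨hy, hysimplex.2⟩

theorem perronRoot_of_mem_colStochastic [DecidableEq ι] [Nonempty ι]
    (hA : A ∈ Matrix.colStochastic ℝ ι) : perronRoot A = 1 := by
  obtain ⟨y, ⟨-, hysum⟩, hy⟩ := exists_mem_stdSimplex_mulVec_eq_perronRoot_smul hA.1
  have hsum : ∑ i, (A *ᵥ y) i = ∑ i, y i := Matrix.sum_mulVec_of_mem_colStochastic hA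
  rw [hy] at hsum
  simpa [← Finset.mul_sum, hysum] using hsum

end Real

end PerronFrobenius

namespace DirMultigraph

section Paths

variable {V : Type u} {G : DirMultigraph V} {s t u v : V} {n : ℕ}

lemma hasPath_zero_iff : G.HasPath 0 u v ↔ u = v := by
  constructor
  · rintro ⟨p, rfl, rfl, -⟩
    rfl
  · rintro rfl
    exact ⟨fun _ => u, rfl, rfl, fun i => i.elim0⟩

lemma hasPath_succ_iff : G.HasPath (n + 1) u v ↔ ∃ w, (u, w) ∈ G.edges ∧ G.HasPath n w v := by
  constructor
  · rintro ⟨p, rfl, rfl, hp⟩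
    exact ⟨p 1, hp 0, fun i => p i.succ, rfl, rfl, fun i => hp i.succ⟩
  · rintro ⟨w, huw, p, rfl, rfl, hp⟩
    exact ⟨Fin.cons u p, rfl, rfl, Fin.cases huw hp⟩

lemma hasPath_one_iff : G.HasPath 1 u v ↔ (u, v) ∈ G.edges := by
  simp only [hasPath_succ_iff, hasPath_zero_iff, exists_eq_right]

lemma hasPath_two_iff : G.HasPath 2 u v ↔ ∃ w, (u, w) ∈ G.edges ∧ (w, v) ∈ G.edges := by
  rw [hasPath_succ_iff]
  simp only [hasPath_one_iff]

lemma HasPath.pow_apply_pos [Fintype V] [DecidableEq V] {R : Type*} [Semiring R] [LinearOrder R]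
    [IsStrictOrderedRing R] {M : Matrix V V R} (hM : ∀ i j, 0 ≤ M i j)
    (hE : ∀ u v, (u, v) ∈ G.edges → 0 < M v u) (h : G.HasPath n u v) : 0 < (M ^ n) v u := by
  induction n generalizing u with
  | zero =>
    obtain rfl := hasPath_zero_iff.1 h
    rw [pow_zero, Matrix.one_apply_eq]
    exact one_pos
  | succ n ih =>
    obtain ⟨w, huw, hwv⟩ := hasPath_succ_iff.1 h
    rw [pow_succ, Matrix.mul_apply]
    exact Finset.sum_pos' (fun j _ => mul_nonneg (Matrix.pow_apply_nonneg hM n v j) (hM j u))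
      ⟨w, Finset.mem_univ w, mul_pos (ih hwv) (hE u w huw)⟩

lemma HasPath.mem_of_isClosed {P : Set V} (hP : ∀ e ∈ G.edges, e.1 ∈ P → e.2 ∈ P)
    (h : G.HasPath n u v) (hu : u ∈ P) : v ∈ P := by
  induction n generalizing u with
  | zero => exact hasPath_zero_iff.1 h ▸ hu
  | succ n ih =>
    obtain ⟨w, huw, hwv⟩ := hasPath_succ_iff.1 h
    exact ih hwv (hP _ huw hu)

lemma dist_eq_top {P : Set V} (hP : ∀ e ∈ G.edges, e.1 ∈ P → e.2 ∈ P) (hs : s ∈ P)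
    (ht : t ∉ P) : G.dist s t = ⊤ := by
  refine sInf_eq_top.2 ?_
  rintro _ ⟨n, -, h, rfl⟩
  exact absurd (h.mem_of_isClosed hP hs) ht

lemma dist_eq_one (h : (s, t) ∈ G.edges) : G.dist s t = 1 := by
  refine le_antisymm (sInf_le ⟨1, le_rfl, hasPath_one_iff.2 h, rfl⟩) (le_sInf ?_)
  rintro _ ⟨n, hn, -, rfl⟩
  exact_mod_cast hn

lemma dist_eq_two (hst : (s, t) ∉ G.edges) (h : G.HasPath 2 s t) : G.dist s t = 2 := by
  refine le_antisymm (sInf_le ⟨2, one_le_two, h, rfl⟩) (le_sInf ?_)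
  rintro _ ⟨n, hn, hp, rfl⟩
  have hn1 : 1 ≠ n := by
    rintro rfl
    exact hst (hasPath_one_iff.1 hp)
  exact_mod_cast hn.lt_of_ne hn1

lemma StronglyConnected.exists_edge (hG : G.StronglyConnected) (u : V) :
    ∃ v, (u, v) ∈ G.edges := by
  obtain ⟨n, hn, h⟩ := hG.2 u u
  obtain ⟨n, rfl⟩ := Nat.exists_eq_succ_of_ne_zero (Nat.one_le_iff_ne_zero.1 hn)
  exact (hasPath_succ_iff.1 h).imp fun _ => And.left

lemma StronglyConnected.isIrreducible [Finite V] {R : Type*} [Ring R] [LinearOrder R]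
    [IsStrictOrderedRing R] {M : Matrix V V R} (hG : G.StronglyConnected)
    (hM : ∀ i j, 0 ≤ M i j) (hE : ∀ u v, (u, v) ∈ G.edges → 0 < M v u) : M.IsIrreducible := by
  classical
  have := Fintype.ofFinite V
  refine (Matrix.isIrreducible_iff_exists_pow_pos hM).2 fun v u => ?_
  obtain ⟨n, hn, h⟩ := hG.2 u v
  exact ⟨n, hn, h.pow_apply_pos hM hE⟩

end Paths

section Matrices

variable {V : Type u} [DecidableEq V] {G : DirMultigraph V}

lemma outDegree_pos_of_mem {u v : V} (h : (u, v) ∈ G.edges) : 0 < G.outDegree u :=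
  Multiset.card_pos_iff_exists_mem.2 ⟨(u, v), Multiset.mem_filter.2 ⟨h, rfl⟩⟩

lemma adjMatrix_nonneg (G : DirMultigraph V) (v u : V) : 0 ≤ G.adjMatrix v u :=
  Nat.cast_nonneg _

lemma StronglyConnected.isIrreducible_adjMatrix [Finite V] (hG : G.StronglyConnected) :
    G.adjMatrix.IsIrreducible :=
  hG.isIrreducible G.adjMatrix_nonneg fun _ _ h => Nat.cast_pos.2 (Multiset.count_pos.2 h)

/-- The transition matrix of the random walk along outgoing edges, whose fixed vectors are the
solutions of the Katz prestige equations. A column of a node without outgoing edges is zero. -/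
noncomputable def walkMatrix (G : DirMultigraph V) : Matrix V V ℝ :=
  Matrix.of fun v u => (G.mult u v : ℝ) / G.outDegree u

lemma walkMatrix_nonneg (G : DirMultigraph V) (v u : V) : 0 ≤ G.walkMatrix v u :=
  div_nonneg (Nat.cast_nonneg _) (Nat.cast_nonneg _)

lemma StronglyConnected.isIrreducible_walkMatrix [Finite V] (hG : G.StronglyConnected) :
    G.walkMatrix.IsIrreducible :=
  hG.isIrreducible G.walkMatrix_nonneg fun _ _ h =>
    div_pos (Nat.cast_pos.2 (Multiset.count_pos.2 h)) (Nat.cast_pos.2 (outDegree_pos_of_mem h))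

variable [Fintype V]

lemma inEdges_eq_sum (G : DirMultigraph V) (v : V) :
    G.inEdges v = ∑ u, Multiset.replicate (G.mult u v) (u, v) := by
  ext ⟨s, t⟩
  simp only [inEdges, mult, Multiset.count_filter, Multiset.count_sum', Multiset.count_replicate,
    Prod.mk.injEq]
  by_cases h : t = v
  · simp [h]
  · simp [h, Ne.symm h]

lemma outEdges_eq_sum (G : DirMultigraph V) (u : V) :
    G.outEdges u = ∑ v, Multiset.replicate (G.mult u v) (u, v) := by
  ext ⟨s, t⟩
  simp only [outEdges, mult, Multiset.count_filter, Multiset.count_sum', Multiset.count_replicate,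
    Prod.mk.injEq]
  by_cases h : s = u
  · simp [h]
  · simp [h, Ne.symm h]

lemma sum_map_inEdges {R : Type*} [NonAssocSemiring R] (G : DirMultigraph V) (f : V → R) (v : V) :
    ((G.inEdges v).map fun e => f e.1).sum = ∑ u, (G.mult u v : R) * f u := by
  have hmap := map_sum (Multiset.mapAddMonoidHom fun e : V × V => f e.1)
    (fun u => Multiset.replicate (G.mult u v) (u, v)) Finset.univ
  simp only [Multiset.coe_mapAddMonoidHom, Multiset.map_replicate] at hmap
  simp only [inEdges_eq_sum, hmap, Multiset.sum_sum, Multiset.sum_replicate, nsmul_eq_mul]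

lemma sum_mult (G : DirMultigraph V) (u : V) : ∑ v, G.mult u v = G.outDegree u := by
  simp only [outDegree, outEdges_eq_sum, Multiset.card_sum, Multiset.card_replicate]

lemma adjMatrix_mulVec (G : DirMultigraph V) (x : V → ℝ) (v : V) :
    (G.adjMatrix *ᵥ x) v = ((G.inEdges v).map fun e => x e.1).sum :=
  (G.sum_map_inEdges x v).symm

theorem lam_eq_perronRoot (G : DirMultigraph V) :
    G.lam = PerronFrobenius.perronRoot G.adjMatrix := by
  cases isEmpty_or_nonempty V with
  | inl hV =>
    have hempty : {c : ℝ | ∃ x : V → ℝ, x ≠ 0 ∧ G.adjMatrix *ᵥ x = c • x} = ∅ :=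
      Set.eq_empty_of_forall_notMem fun _ ⟨_, hx, _⟩ => hx (Subsingleton.elim _ _)
    rw [lam, hempty, Real.sSup_empty, PerronFrobenius.perronRoot_of_isEmpty]
  | inr hV => exact (PerronFrobenius.isGreatest_perronRoot G.adjMatrix_nonneg).csSup_eq

lemma walkMatrix_mulVec (G : DirMultigraph V) (x : V → ℝ) (v : V) :
    (G.walkMatrix *ᵥ x) v =
      ((G.inEdges v).map fun e => x e.1 / (G.outDegree e.1 : ℝ)).sum := by
  rw [sum_map_inEdges G fun u => x u / (G.outDegree u : ℝ)]
  exact Finset.sum_congr rfl fun u _ => div_mul_eq_mul_div₀ _ _ _ |>.trans (mul_div_assoc _ _ _)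

lemma StronglyConnected.walkMatrix_mem_colStochastic (hG : G.StronglyConnected) :
    G.walkMatrix ∈ Matrix.colStochastic ℝ V := by
  refine Matrix.mem_colStochastic_iff_sum.2 ⟨G.walkMatrix_nonneg, fun u => ?_⟩
  obtain ⟨v, huv⟩ := hG.exists_edge u
  have hdeg : (G.outDegree u : ℝ) ≠ 0 := Nat.cast_ne_zero.2 (outDegree_pos_of_mem huv).ne'
  simp only [walkMatrix, Matrix.of_apply]
  rw [← Finset.sum_div, ← Nat.cast_sum, sum_mult, div_self hdeg]

end Matrices

section Systems

lemma definesCentralityOn_of_exists_forall_iff_eq {C : GraphClass.{u}} {S : CentralitySystem.{u}}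
    (h : ∀ (V : Type u) [Fintype V] [DecidableEq V] (G : DirMultigraph V) (b : V → ℝ≥0),
      C V G → ∃ y : V → ℝ, (∀ v, 0 ≤ y v) ∧ ∀ x, S V G b x ↔ x = y) :
    DefinesCentralityOn C S := by
  intro V _ _ G b hG
  obtain ⟨y, hy, hSy⟩ := h V G b hG
  simp only [hSy, existsUnique_eq, true_and]
  rintro _ rfl
  exact hy

lemma DefinesCentralityOn.iff_eq_solution {C : GraphClass.{u}} {S : CentralitySystem.{u}}
    (h : DefinesCentralityOn C S) {V : Type u} [Fintype V] [DecidableEq V] {G : DirMultigraph V}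
    {b : V → ℝ≥0} (hG : C V G) {x : V → ℝ} : S V G b x ↔ x = S.solution V G b := by
  have hsol : S V G b (S.solution V G b) := Classical.epsilon_spec (h V G b hG).1.exists
  refine ⟨fun hx => (h V G b hG).1.unique hx hsol, ?_⟩
  rintro rfl
  exact hsol

variable {V : Type u} [Fintype V] [DecidableEq V] {G : DirMultigraph V} {b : V → ℝ≥0}
  {x : V → ℝ} {a : ℝ}

theorem StronglyConnected.lam_eq_of_nonneg (hG : G.StronglyConnected) {c : ℝ} (hx : 0 ≤ x)
    (hx0 : x ≠ 0) (hc : G.adjMatrix *ᵥ x = c • x) : G.lam = c :=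
  G.lam_eq_perronRoot.trans <|
    PerronFrobenius.perronRoot_eq_of_isIrreducible hG.isIrreducible_adjMatrix hx hx0 hc

lemma StronglyConnected.exists_pos_forall_eigenvector_iff_eq (hG : G.StronglyConnected) :
    ∃ y : V → ℝ, (∀ v, 0 < y v) ∧
      ∀ x, G.adjMatrix *ᵥ x = G.lam • x ∧ ∑ v, x v = 1 ↔ x = y := by
  have := hG.1
  rw [lam_eq_perronRoot]
  exact PerronFrobenius.exists_pos_forall_iff_eq_of_isIrreducible hG.isIrreducible_adjMatrix

lemma StronglyConnected.lam_pos (hG : G.StronglyConnected) : 0 < G.lam := by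
  obtain ⟨v⟩ := hG.1
  obtain ⟨y, hy, hiff⟩ := hG.exists_pos_forall_eigenvector_iff_eq
  exact (PerronFrobenius.pos_of_isIrreducible hG.isIrreducible_adjMatrix (fun v => (hy v).le)
    (fun h => (hy v).ne' (congrFun h v)) ((hiff y).2 rfl).1).1

lemma eigenvectorSystem_iff (hlam : G.lam ≠ 0) :
    eigenvectorSystem V G b x ↔ G.adjMatrix *ᵥ x = G.lam • x ∧ ∑ v, x v = 1 := by
  refine and_congr_left fun _ => Iff.trans (forall_congr' fun v => ?_) funext_iff.symm
  rw [adjMatrix_mulVec, Pi.smul_apply, smul_eq_mul, one_div, eq_inv_mul_iff_mul_eq₀ hlam, eq_comm]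

theorem definesCentralityOn_eigenvectorSystem :
    DefinesCentralityOn.{u} scGraphs eigenvectorSystem := by
  refine definesCentralityOn_of_exists_forall_iff_eq fun V _ _ G b hG => ?_
  obtain ⟨y, hy, hiff⟩ := StronglyConnected.exists_pos_forall_eigenvector_iff_eq hG
  have hlam : 0 < G.lam := StronglyConnected.lam_pos hG
  exact ⟨y, fun v => (hy v).le, fun x => (eigenvectorSystem_iff hlam.ne').trans (hiff x)⟩

lemma katzPrestigeSystem_iff :
    katzPrestigeSystem V G b x ↔ G.walkMatrix *ᵥ x = (1 : ℝ) • x ∧ ∑ v, x v = 1 := by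
  refine and_congr_left fun _ => Iff.trans (forall_congr' fun v => ?_) funext_iff.symm
  rw [walkMatrix_mulVec, one_smul, eq_comm]

theorem definesCentralityOn_katzPrestigeSystem :
    DefinesCentralityOn.{u} scGraphs katzPrestigeSystem := by
  refine definesCentralityOn_of_exists_forall_iff_eq fun V _ _ G b (hG : G.StronglyConnected) => ?_
  have := hG.1
  obtain ⟨y, hy, hiff⟩ :=
    PerronFrobenius.exists_pos_forall_iff_eq_of_isIrreducible hG.isIrreducible_walkMatrix
  rw [PerronFrobenius.perronRoot_of_mem_colStochastic hG.walkMatrix_mem_colStochastic] at hiff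
  exact ⟨y, fun v => (hy v).le, fun x => katzPrestigeSystem_iff.trans (hiff x)⟩

lemma exists_nonneg_forall_eq_smul_mulVec_add_iff_eq (ha : 0 < a) (hG : G.lam < 1 / a)
    {c : V → ℝ} (hc : 0 ≤ c) :
    ∃ y : V → ℝ, (∀ v, 0 ≤ y v) ∧ ∀ x, x = a • (G.adjMatrix *ᵥ x) + c ↔ x = y := by
  have hsuper : PerronFrobenius.HasStrictSupersolution G.adjMatrix a⁻¹ := by
    rw [lam_eq_perronRoot, one_div] at hG
    exact PerronFrobenius.hasStrictSupersolution_of_perronRoot_lt hG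
  have hscale (x) : x = a • (G.adjMatrix *ᵥ x) + c ↔ a⁻¹ • x = G.adjMatrix *ᵥ x + a⁻¹ • c := by
    rw [inv_smul_eq_iff₀ ha.ne', smul_add, smul_inv_smul₀ ha.ne']
  obtain ⟨y, hy, huniq⟩ :=
    hsuper.existsUnique_smul_eq_mulVec_add G.adjMatrix_nonneg (a⁻¹ • c)
  have hy0 : 0 ≤ y := hsuper.minimum_principle G.adjMatrix_nonneg <|
    hy ▸ le_add_of_nonneg_right (smul_nonneg (inv_nonneg.2 ha.le) hc)
  refine ⟨y, hy0, fun x => (hscale x).trans ⟨huniq x, ?_⟩⟩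
  rintro rfl
  exact hy

lemma katzSystem_iff :
    katzSystem a V G b x ↔ x = a • (G.adjMatrix *ᵥ x) + fun v => (b v : ℝ) := by
  simp only [katzSystem, funext_iff, Pi.add_apply, Pi.smul_apply, smul_eq_mul, adjMatrix_mulVec]

theorem definesCentralityOn_katzSystem (ha : 0 < a) :
    DefinesCentralityOn.{u} (katzGraphs a) (katzSystem a) := by
  refine definesCentralityOn_of_exists_forall_iff_eq fun V _ _ G b hG => ?_
  simp only [katzSystem_iff]
  exact exists_nonneg_forall_eq_smul_mulVec_add_iff_eq ha hG fun v => (b v).2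

lemma bonacichSystem_iff :
    bonacichSystem a V G b x ↔
      x = a • (G.adjMatrix *ᵥ x) + G.adjMatrix *ᵥ fun v => (b v : ℝ) := by
  simp only [bonacichSystem, Multiset.sum_map_add, Multiset.sum_map_mul_left, funext_iff,
    Pi.add_apply, Pi.smul_apply, smul_eq_mul, adjMatrix_mulVec]

theorem definesCentralityOn_bonacichSystem (ha : 0 < a) :
    DefinesCentralityOn.{u} (katzGraphs a) (bonacichSystem a) := by
  refine definesCentralityOn_of_exists_forall_iff_eq fun V _ _ G b hG => ?_
  simp only [bonacichSystem_iff]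
  exact exists_nonneg_forall_eq_smul_mulVec_add_iff_eq ha hG fun v =>
    dotProduct_nonneg_of_nonneg (G.adjMatrix_nonneg v) fun u => (b u).2

end Systems

section Swap

/-- Solutions of the system that agree on the tails of two edges stay solutions when the ends of
these edges are swapped, provided that the two tails have the same out-degree and both graphs lie
in the class. -/
def CentralitySystem.SwapInvariantOn (C : GraphClass.{u}) (S : CentralitySystem.{u}) : Prop :=
  ∀ (V : Type u) [Fintype V] [DecidableEq V] (G : DirMultigraph V) (b : V → ℝ≥0)
    (u u' w w' : V) (x : V → ℝ),
    C V G → ({(u, u'), (w, w')} : Multiset (V × V)) ≤ G.edges → x u = x w →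
    G.outDegree u = G.outDegree w → C V (G.swap u u' w w') → S V G b x →
    S V (G.swap u u' w w') b x

theorem DefinesCentralityOn.edgeSwapOn_solution {C : GraphClass.{u}} {S : CentralitySystem.{u}}
    (h : DefinesCentralityOn C S) (hswap : S.SwapInvariantOn C) : EdgeSwapOn C S.solution :=
  fun V _ _ G b u u' w w' hG hE hF hd hG' => congrFun <| (h.iff_eq_solution hG').1 <|
    hswap V G b u u' w w' _ hG hE hF hd hG' ((h.iff_eq_solution hG).2 rfl)

variable {V : Type u} [DecidableEq V] {G : DirMultigraph V} {u u' w w' : V}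

lemma exists_edges_eq_add (h : ({(u, u'), (w, w')} : Multiset (V × V)) ≤ G.edges) :
    ∃ E, G.edges = E + {(u, u'), (w, w')} ∧
      (G.swap u u' w w').edges = E + {(u, w'), (w, u')} :=
  ⟨_, (tsub_add_cancel_of_le h).symm, rfl⟩

lemma outDegree_swap (h : ({(u, u'), (w, w')} : Multiset (V × V)) ≤ G.edges) (v : V) :
    (G.swap u u' w w').outDegree v = G.outDegree v := by
  obtain ⟨E, hE, hE'⟩ := exists_edges_eq_add h
  simp only [outDegree, outEdges, hE, hE', Multiset.filter_add, Multiset.card_add,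
    Multiset.insert_eq_cons, Multiset.filter_cons, Multiset.filter_singleton]
  split_ifs <;> rfl

lemma sum_map_inEdges_swap {R : Type*} [AddCommMonoid R]
    (h : ({(u, u'), (w, w')} : Multiset (V × V)) ≤ G.edges) {f : V → R} (hf : f u = f w) (v : V) :
    (((G.swap u u' w w').inEdges v).map fun e => f e.1).sum =
      ((G.inEdges v).map fun e => f e.1).sum := by
  obtain ⟨E, hE, hE'⟩ := exists_edges_eq_add h
  simp only [inEdges, hE, hE', Multiset.filter_add, Multiset.map_add, Multiset.sum_add,
    Multiset.insert_eq_cons, Multiset.filter_cons, Multiset.filter_singleton]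
  split_ifs <;> simp [hf]

theorem edgeSwapOn_degreeCentrality : EdgeSwapOn.{u} allGraphs degreeCentrality := by
  intro V _ _ G b u u' w w' _ h _ _ _ v
  have hsum := sum_map_inEdges_swap h (f := fun _ => 1) rfl v
  simp only [Multiset.map_const', Multiset.sum_replicate, smul_eq_mul, mul_one] at hsum
  rw [degreeCentrality, degreeCentrality, hsum]

theorem edgeSwapOn_betaMeasure : EdgeSwapOn.{u} allGraphs betaMeasure := by
  intro V _ _ G b u u' w w' _ h _ hd _ v
  simp only [betaMeasure, outDegree_swap h]
  exact (sum_map_inEdges_swap h (f := fun u => 1 / (G.outDegree u : ℝ)) (by rw [hd]) v).symm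

theorem edgeSwapOn_katzCentrality {a : ℝ} (ha : 0 < a) :
    EdgeSwapOn.{u} (katzGraphs a) (katzCentrality a) := by
  refine (definesCentralityOn_katzSystem ha).edgeSwapOn_solution ?_
  intro V _ _ G b u u' w w' x _ h hx _ _ hS v
  rw [sum_map_inEdges_swap h hx]
  exact hS v

theorem edgeSwapOn_katzPrestige : EdgeSwapOn.{u} scGraphs katzPrestige := by
  refine definesCentralityOn_katzPrestigeSystem.edgeSwapOn_solution ?_
  intro V _ _ G b u u' w w' x _ h hx hd _ hS
  refine ⟨fun v => ?_, hS.2⟩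
  simp only [outDegree_swap h]
  rw [sum_map_inEdges_swap h (f := fun u => x u / (G.outDegree u : ℝ)) (by rw [hd, hx])]
  exact hS.1 v

theorem lam_swap_of_eigenvectorSystem [Fintype V] {b : V → ℝ≥0} (hG : G.StronglyConnected)
    (h : ({(u, u'), (w, w')} : Multiset (V × V)) ≤ G.edges) {x : V → ℝ} (hx : x u = x w)
    (hG' : (G.swap u u' w w').StronglyConnected) (hS : eigenvectorSystem V G b x) :
    (G.swap u u' w w').lam = G.lam := by
  obtain ⟨y, hy, hiff⟩ := hG.exists_pos_forall_eigenvector_iff_eq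
  have heig := (eigenvectorSystem_iff hG.lam_pos.ne').1 hS
  obtain rfl := (hiff x).1 heig
  refine hG'.lam_eq_of_nonneg (fun v => (hy v).le) (fun h0 => (hy u).ne' (congrFun h0 u)) ?_
  rw [← heig.1]
  ext v
  rw [adjMatrix_mulVec, adjMatrix_mulVec, sum_map_inEdges_swap h hx]

theorem edgeSwapOn_eigenvectorCentrality : EdgeSwapOn.{u} scGraphs eigenvectorCentrality := by
  refine definesCentralityOn_eigenvectorSystem.edgeSwapOn_solution ?_
  intro V _ _ G b u u' w w' x hG h hx _ hG' hS
  refine ⟨fun v => ?_, hS.2⟩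
  rw [sum_map_inEdges_swap h hx, lam_swap_of_eigenvectorSystem hG h hx hG' hS]
  exact hS.1 v

end Swap

section Bonacich

variable {V : Type u} [Fintype V] [DecidableEq V] {G : DirMultigraph V} {b : V → ℝ≥0} {a : ℝ}

lemma lam_nonpos_of_rank (f : V → ℕ) (hf : ∀ e ∈ G.edges, f e.1 < f e.2) : G.lam ≤ 0 := by
  refine Real.sSup_nonpos fun c ⟨x, hx, hc⟩ => ?_
  by_contra! hcpos
  refine hx (funext fun v => ?_)
  induction hn : f v using Nat.strong_induction_on generalizing v with
  | _ n ih =>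
    have hsum : ((G.inEdges v).map fun e => x e.1).sum = 0 := by
      refine Multiset.sum_eq_zero fun y hy => ?_
      obtain ⟨e, he, rfl⟩ := Multiset.mem_map.1 hy
      obtain ⟨hedge, rfl⟩ := Multiset.mem_filter.1 he
      exact ih _ (hn ▸ hf e hedge) _ rfl
    have hcv : c * x v = 0 := by rw [← hsum, ← adjMatrix_mulVec, hc, Pi.smul_apply, smul_eq_mul]
    exact (mul_eq_zero.1 hcv).resolve_left hcpos.ne'

lemma katzGraphs_of_rank (ha : 0 < a) (f : V → ℕ) (hf : ∀ e ∈ G.edges, f e.1 < f e.2) :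
    katzGraphs a V G :=
  (lam_nonpos_of_rank f hf).trans_lt (one_div_pos.2 ha)

lemma bonacichCentrality_apply (ha : 0 < a) (hG : katzGraphs a V G) (v : V) :
    bonacichCentrality a V G b v =
      ((G.inEdges v).map fun e => a * bonacichCentrality a V G b e.1 + (b e.1 : ℝ)).sum :=
  ((definesCentralityOn_bonacichSystem ha).iff_eq_solution hG).2 rfl v

lemma bonacichCentrality_of_inEdges_eq_zero (ha : 0 < a) (hG : katzGraphs a V G) {v : V}
    (hv : G.inEdges v = 0) : bonacichCentrality a V G b v = 0 := by
  rw [bonacichCentrality_apply ha hG, hv, Multiset.map_zero, Multiset.sum_zero]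

lemma bonacichCentrality_of_inEdges_eq_singleton (ha : 0 < a) (hG : katzGraphs a V G) {u v : V}
    (hu : G.inEdges u = 0) (hv : G.inEdges v = {(u, v)}) :
    bonacichCentrality a V G b v = b u := by
  rw [bonacichCentrality_apply ha hG, hv, Multiset.map_singleton, Multiset.sum_singleton,
    bonacichCentrality_of_inEdges_eq_zero ha hG hu, mul_zero, zero_add]

/-- Two disjoint edges, a counterexample for Bonacich centrality: swapping their ends exposes
node `2` to the weight of node `1` instead of that of node `0`. -/
def parallelEdges : DirMultigraph (ULift.{u} (Fin 4)) := ⟨{(⟨0⟩, ⟨2⟩), (⟨1⟩, ⟨3⟩)}⟩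

theorem not_edgeSwapOn_bonacichCentrality (ha : 0 < a) :
    ¬ EdgeSwapOn.{u} (katzGraphs a) (bonacichCentrality a) := by
  intro hswap
  let b : ULift.{u} (Fin 4) → ℝ≥0 := Pi.single ⟨0⟩ 1
  have hG : katzGraphs a _ parallelEdges.{u} :=
    katzGraphs_of_rank ha (fun v => v.down) (by decide)
  have hG' : katzGraphs a _ (parallelEdges.{u}.swap ⟨0⟩ ⟨2⟩ ⟨1⟩ ⟨3⟩) :=
    katzGraphs_of_rank ha (fun v => v.down) (by decide)
  have h0 : bonacichCentrality a _ parallelEdges.{u} b ⟨0⟩ = 0 :=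
    bonacichCentrality_of_inEdges_eq_zero ha hG (by decide)
  have h1 : bonacichCentrality a _ parallelEdges.{u} b ⟨1⟩ = 0 :=
    bonacichCentrality_of_inEdges_eq_zero ha hG (by decide)
  have h2 : bonacichCentrality a _ parallelEdges.{u} b ⟨2⟩ = b ⟨0⟩ :=
    bonacichCentrality_of_inEdges_eq_singleton ha hG (by decide) (by decide)
  have h2' : bonacichCentrality a _ (parallelEdges.{u}.swap ⟨0⟩ ⟨2⟩ ⟨1⟩ ⟨3⟩) b ⟨2⟩ = b ⟨1⟩ :=
    bonacichCentrality_of_inEdges_eq_singleton ha hG' (by decide) (by decide)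
  have heq : (b ⟨0⟩ : ℝ) = b ⟨1⟩ := by
    rw [← h2, ← h2']
    exact hswap _ _ b ⟨0⟩ ⟨2⟩ ⟨1⟩ ⟨3⟩ hG le_rfl (h0.trans h1.symm) (by decide) hG' ⟨2⟩
  simp [b] at heq

end Bonacich

section Decay

variable {V : Type u} [Fintype V] [DecidableEq V] {G : DirMultigraph V} {a : ℝ} {v : V}

lemma decayCentrality_of_forall_dist_eq_top (b : V → ℝ≥0) (h : ∀ u ≠ v, G.dist u v = ⊤) :
    decayCentrality a V G b v = 0 :=
  Finset.sum_eq_zero fun u hu => if_pos (h u (Finset.ne_of_mem_erase hu))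

lemma decayCentrality_of_forall_mem_edges (b : V → ℝ≥0) (h : ∀ u ≠ v, (u, v) ∈ G.edges) :
    decayCentrality a V G b v = (Fintype.card V - 1 : ℕ) * a := by
  have hterm : ∀ u ∈ Finset.univ.erase v,
      (if G.dist u v = ⊤ then 0 else a ^ (G.dist u v).toNat) = a := by
    intro u hu
    simp [dist_eq_one (h u (Finset.ne_of_mem_erase hu))]
  rw [decayCentrality, Finset.sum_congr rfl hterm, Finset.sum_const,
    Finset.card_erase_of_mem (Finset.mem_univ v), Finset.card_univ, nsmul_eq_mul]

/-- A loop at each of two nodes, a counterexample for decay centrality: swapping the ends of the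
loops connects the two nodes. -/
def twoLoops : DirMultigraph (ULift.{u} (Fin 2)) := ⟨{(⟨0⟩, ⟨0⟩), (⟨1⟩, ⟨1⟩)}⟩

lemma dist_twoLoops {s t : ULift.{u} (Fin 2)} (hst : s ≠ t) : twoLoops.dist s t = ⊤ := by
  have hloop : ∀ e ∈ twoLoops.{u}.edges, e.1 = e.2 := by decide
  exact dist_eq_top (P := {s}) (fun e he hs => (hloop e he).symm.trans hs) rfl hst.symm

lemma mem_edges_twoLoops_swap :
    ∀ u ≠ (⟨0⟩ : ULift.{u} (Fin 2)), (u, ⟨0⟩) ∈ (twoLoops.swap ⟨0⟩ ⟨0⟩ ⟨1⟩ ⟨1⟩).edges := by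
  decide

theorem not_edgeSwapOn_decayCentrality (ha : a ≠ 0) :
    ¬ EdgeSwapOn.{u} allGraphs (decayCentrality a) := by
  intro hswap
  have hzero (v) : decayCentrality a _ twoLoops.{u} 0 v = 0 :=
    decayCentrality_of_forall_dist_eq_top 0 fun _ hu => dist_twoLoops hu
  have h0' : decayCentrality a _ (twoLoops.{u}.swap ⟨0⟩ ⟨0⟩ ⟨1⟩ ⟨1⟩) 0 ⟨0⟩ = a := by
    rw [decayCentrality_of_forall_mem_edges 0 mem_edges_twoLoops_swap]
    simp
  have heq := hswap _ twoLoops.{u} 0 ⟨0⟩ ⟨0⟩ ⟨1⟩ ⟨1⟩ trivial le_rfl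
    ((hzero _).trans (hzero _).symm) (by decide) trivial ⟨0⟩
  rw [hzero, h0'] at heq
  exact ha heq.symm

end Decay

section ClosenessAndBetweenness

variable {V : Type u} [DecidableEq V] {G : DirMultigraph V} {s t v : V}

/-- The distance from `s` to `t` in a graph in which a path of length two joins them, in a form
that can be computed. -/
def twoStepDist (G : DirMultigraph V) (s t : V) : ℕ :=
  if (s, t) ∈ G.edges then 1 else 2

lemma dist_eq_twoStepDist (h : G.HasPath 2 s t) : G.dist s t = G.twoStepDist s t := by
  rw [twoStepDist]
  split_ifs with hst
  · exact dist_eq_one hst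
  · exact dist_eq_two hst h

variable [Fintype V]

lemma closenessCentrality_eq_one_div (b : V → ℝ≥0) (h : ∀ s t, G.HasPath 2 s t) (v : V) :
    closenessCentrality V G b v = 1 / (∑ u ∈ Finset.univ.erase v, G.twoStepDist u v : ℕ) := by
  simp only [closenessCentrality, dist_eq_twoStepDist (h _ _), ENat.toNat_natCast, Nat.cast_sum]

lemma numShortestPaths_eq_numPaths (h : G.HasPath 2 s t) :
    G.numShortestPaths s t = G.numPaths (G.twoStepDist s t) s t := by
  rw [numShortestPaths, dist_eq_twoStepDist h, if_neg (ENat.natCast_ne_top _), ENat.toNat_natCast]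

lemma numShortestPathsThrough_eq_numPathsThrough (h : G.HasPath 2 s t) (v : V) :
    G.numShortestPathsThrough s t v = G.numPathsThrough (G.twoStepDist s t) s t v := by
  rw [numShortestPathsThrough, dist_eq_twoStepDist h, if_neg (ENat.natCast_ne_top _),
    ENat.toNat_natCast]

lemma betweennessCentrality_eq_sum (b : V → ℝ≥0) (h : ∀ s t, G.HasPath 2 s t)
    (huniq : ∀ s t, s ≠ t → G.numPaths (G.twoStepDist s t) s t = 1) (v : V) :
    betweennessCentrality V G b v =
      (∑ s ∈ Finset.univ.erase v, ∑ t ∈ (Finset.univ.erase v).erase s,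
        G.numPathsThrough (G.twoStepDist s t) s t v : ℕ) := by
  push_cast
  refine Finset.sum_congr rfl fun s _ => Finset.sum_congr rfl fun t ht => ?_
  have hst : G.numShortestPaths s t = 1 :=
    (numShortestPaths_eq_numPaths (h s t)).trans (huniq s t (Finset.ne_of_mem_erase ht).symm)
  rw [hst, if_pos one_ne_zero, Nat.cast_one, div_one,
    numShortestPathsThrough_eq_numPathsThrough (h s t)]

/-- The directed triangle with a loop at each node, a counterexample for closeness and betweenness
centrality: swapping the ends of the loop at `0` and of the edge `1 → 2` yields the path
`1 ⇄ 0 ⇄ 2` with loops at `1` and `2`. -/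
def loopedTriangle : DirMultigraph (ULift.{u} (Fin 3)) :=
  ⟨{(⟨0⟩, ⟨0⟩), (⟨1⟩, ⟨2⟩), (⟨0⟩, ⟨1⟩), (⟨1⟩, ⟨1⟩), (⟨2⟩, ⟨0⟩), (⟨2⟩, ⟨2⟩)}⟩

lemma hasPath_two_loopedTriangle (s t : ULift.{u} (Fin 3)) : loopedTriangle.HasPath 2 s t := by
  rw [hasPath_two_iff]
  revert s t
  decide

lemma hasPath_two_loopedTriangle_swap (s t : ULift.{u} (Fin 3)) :
    (loopedTriangle.swap ⟨0⟩ ⟨0⟩ ⟨1⟩ ⟨2⟩).HasPath 2 s t := by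
  rw [hasPath_two_iff]
  revert s t
  decide

theorem not_edgeSwapOn_closenessCentrality : ¬ EdgeSwapOn.{u} scGraphs closenessCentrality := by
  intro hswap
  have h0 : closenessCentrality _ loopedTriangle.{u} 0 ⟨0⟩ = 1 / (3 : ℕ) :=
    closenessCentrality_eq_one_div 0 hasPath_two_loopedTriangle _
  have h1 : closenessCentrality _ loopedTriangle.{u} 0 ⟨1⟩ = 1 / (3 : ℕ) :=
    closenessCentrality_eq_one_div 0 hasPath_two_loopedTriangle _
  have h0' : closenessCentrality _ (loopedTriangle.{u}.swap ⟨0⟩ ⟨0⟩ ⟨1⟩ ⟨2⟩) 0 ⟨0⟩ = 1 / (2 : ℕ) :=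
    closenessCentrality_eq_one_div 0 hasPath_two_loopedTriangle_swap _
  have heq := hswap _ loopedTriangle.{u} 0 ⟨0⟩ ⟨0⟩ ⟨1⟩ ⟨2⟩
    ⟨⟨⟨0⟩⟩, fun s t => ⟨2, one_le_two, hasPath_two_loopedTriangle s t⟩⟩ (by decide)
    (h0.trans h1.symm) (by decide)
    ⟨⟨⟨0⟩⟩, fun s t => ⟨2, one_le_two, hasPath_two_loopedTriangle_swap s t⟩⟩ ⟨0⟩
  rw [h0, h0'] at heq
  norm_num at heq

theorem not_edgeSwapOn_betweennessCentrality :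
    ¬ EdgeSwapOn.{u} allGraphs betweennessCentrality := by
  intro hswap
  have huniq : ∀ s t : ULift.{u} (Fin 3), s ≠ t →
      loopedTriangle.numPaths (loopedTriangle.twoStepDist s t) s t = 1 := by decide
  have h0 : betweennessCentrality _ loopedTriangle.{u} 0 ⟨0⟩ = (1 : ℕ) :=
    (betweennessCentrality_eq_sum 0 hasPath_two_loopedTriangle huniq ⟨0⟩).trans
      (congrArg _ (by decide))
  have h1 : betweennessCentrality _ loopedTriangle.{u} 0 ⟨1⟩ = (1 : ℕ) :=
    (betweennessCentrality_eq_sum 0 hasPath_two_loopedTriangle huniq ⟨1⟩).trans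
      (congrArg _ (by decide))
  have h0' : betweennessCentrality _ (loopedTriangle.{u}.swap ⟨0⟩ ⟨0⟩ ⟨1⟩ ⟨2⟩) 0 ⟨0⟩ = (2 : ℕ) :=
    (betweennessCentrality_eq_sum 0 hasPath_two_loopedTriangle_swap (by decide) ⟨0⟩).trans
      (congrArg _ (by decide))
  have heq := hswap _ loopedTriangle.{u} 0 ⟨0⟩ ⟨0⟩ ⟨1⟩ ⟨2⟩ trivial (by decide)
    (h0.trans h1.symm) (by decide) trivial ⟨0⟩
  rw [h0, h0'] at heq
  norm_num at heq

end ClosenessAndBetweenness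

end DirMultigraph

open DirMultigraph in
theorem mainTheorem8_general :
    (DefinesCentralityOn.{u} scGraphs eigenvectorSystem ∧
      DefinesCentralityOn.{u} scGraphs katzPrestigeSystem ∧
      ∀ a : ℝ, 0 < a →
        DefinesCentralityOn.{u} (katzGraphs a) (katzSystem a) ∧
          DefinesCentralityOn.{u} (katzGraphs a) (bonacichSystem a)) ∧
    (EdgeSwapOn.{u} allGraphs degreeCentrality ∧
      EdgeSwapOn.{u} allGraphs betaMeasure ∧
      EdgeSwapOn.{u} scGraphs eigenvectorCentrality ∧
      EdgeSwapOn.{u} scGraphs katzPrestige ∧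
      ∀ a : ℝ, 0 < a → EdgeSwapOn.{u} (katzGraphs a) (katzCentrality a)) ∧
    ((∀ a : ℝ, 0 < a → ¬ EdgeSwapOn.{u} (katzGraphs a) (bonacichCentrality a)) ∧
      ¬ EdgeSwapOn.{u} scGraphs closenessCentrality ∧
      (∀ a : ℝ, a ≠ 0 → ¬ EdgeSwapOn.{u} allGraphs (decayCentrality a)) ∧
      ¬ EdgeSwapOn.{u} allGraphs betweennessCentrality) ∧
    (∀ (V : Type u) [Fintype V] [DecidableEq V] (G : DirMultigraph V) (c : ℝ) (x : V → ℝ),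
      G.StronglyConnected → 0 ≤ x → x ≠ 0 → G.adjMatrix *ᵥ x = c • x → G.lam = c) ∧
    (∀ (V : Type u) [Fintype V] [DecidableEq V] (G : DirMultigraph V) (b : V → ℝ≥0)
      (u u' w w' : V),
      G.StronglyConnected → ({(u, u'), (w, w')} : Multiset (V × V)) ≤ G.edges →
      eigenvectorCentrality V G b u = eigenvectorCentrality V G b w →
      (G.swap u u' w w').StronglyConnected →
      G.lam = (G.swap u u' w w').lam) := by
  refine ⟨⟨definesCentralityOn_eigenvectorSystem, definesCentralityOn_katzPrestigeSystem,
      fun a ha => ⟨definesCentralityOn_katzSystem ha, definesCentralityOn_bonacichSystem ha⟩⟩,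
    ⟨edgeSwapOn_degreeCentrality, edgeSwapOn_betaMeasure, edgeSwapOn_eigenvectorCentrality,
      edgeSwapOn_katzPrestige, fun a ha => edgeSwapOn_katzCentrality ha⟩,
    ⟨fun a ha => not_edgeSwapOn_bonacichCentrality ha, not_edgeSwapOn_closenessCentrality,
      fun a ha => not_edgeSwapOn_decayCentrality ha, not_edgeSwapOn_betweennessCentrality⟩,
    fun V _ _ G c x hG hx hx0 hc => hG.lam_eq_of_nonneg hx hx0 hc,
    fun V _ _ G b u u' w w' hG h hF hG' => ?_⟩
  have hx : eigenvectorSystem V G b (eigenvectorCentrality V G b) :=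
    (definesCentralityOn_eigenvectorSystem.iff_eq_solution hG).2 rfl
  exact (lam_swap_of_eigenvectorSystem hG h hF hG' hx).symm

theorem mainTheorem8 :
    -- the centralities given by equations are well defined on their classes
    (DirMultigraph.DefinesCentralityOn.{u} DirMultigraph.scGraphs
        DirMultigraph.eigenvectorSystem ∧
      DirMultigraph.DefinesCentralityOn.{u} DirMultigraph.scGraphs
        DirMultigraph.katzPrestigeSystem ∧
      ∀ a : ℝ, 0 < a → a < 1 →
        DirMultigraph.DefinesCentralityOn.{u} (DirMultigraph.katzGraphs a)
            (DirMultigraph.katzSystem a) ∧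
          DirMultigraph.DefinesCentralityOn.{u} (DirMultigraph.katzGraphs a)
            (DirMultigraph.bonacichSystem a)) ∧
    -- Edge Swap holds
    (DirMultigraph.EdgeSwapOn.{u} DirMultigraph.allGraphs DirMultigraph.degreeCentrality ∧
      DirMultigraph.EdgeSwapOn.{u} DirMultigraph.allGraphs DirMultigraph.betaMeasure ∧
      DirMultigraph.EdgeSwapOn.{u} DirMultigraph.scGraphs DirMultigraph.eigenvectorCentrality ∧
      DirMultigraph.EdgeSwapOn.{u} DirMultigraph.scGraphs DirMultigraph.katzPrestige ∧
      ∀ a : ℝ, 0 < a → a < 1 →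
        DirMultigraph.EdgeSwapOn.{u} (DirMultigraph.katzGraphs a)
          (DirMultigraph.katzCentrality a)) ∧
    -- Edge Swap fails
    ((∀ a : ℝ, 0 < a → a < 1 →
        ¬ DirMultigraph.EdgeSwapOn.{u} (DirMultigraph.katzGraphs a)
            (DirMultigraph.bonacichCentrality a)) ∧
      ¬ DirMultigraph.EdgeSwapOn.{u} DirMultigraph.scGraphs
          DirMultigraph.closenessCentrality ∧
      (∀ a : ℝ, 0 < a → a < 1 →
        ¬ DirMultigraph.EdgeSwapOn.{u} DirMultigraph.allGraphs
            (DirMultigraph.decayCentrality a)) ∧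
      ¬ DirMultigraph.EdgeSwapOn.{u} DirMultigraph.allGraphs
          DirMultigraph.betweennessCentrality) ∧
    -- a positive solution of the eigen-equation belongs to the largest eigenvalue
    (∀ (V : Type u) [Fintype V] [DecidableEq V] (G : DirMultigraph V) (c : ℝ) (x : V → ℝ),
      G.StronglyConnected → (∀ v, 0 < x v) → G.adjMatrix *ᵥ x = c • x → G.lam = c) ∧
    -- the largest eigenvalue does not change in the eigenvector case
    (∀ (V : Type u) [Fintype V] [DecidableEq V] (G : DirMultigraph V) (b : V → ℝ≥0)
      (u u' w w' : V),
      G.StronglyConnected → ({(u, u'), (w, w')} : Multiset (V × V)) ≤ G.edges →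
      DirMultigraph.eigenvectorCentrality V G b u =
        DirMultigraph.eigenvectorCentrality V G b w →
      G.outDegree u = G.outDegree w →
      (G.swap u u' w w').StronglyConnected →
      G.lam = (G.swap u u' w w').lam) := by
  obtain ⟨⟨hE, hP, hK⟩, ⟨sD, sB, sE, sP, sK⟩, ⟨nB, nC, nY, nW⟩, hlam, hswap⟩ :=
    mainTheorem8_general.{u}
  refine ⟨⟨hE, hP, fun a ha _ => hK a ha⟩, ⟨sD, sB, sE, sP, fun a ha _ => sK a ha⟩,
    ⟨fun a ha _ => nB a ha, nC, fun a ha _ => nY a ha.ne', nW⟩,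
    fun V _ _ G c x hG hx hc => hlam V G c x hG (fun v => (hx v).le) ?_ hc,
    fun V _ _ G b u u' w w' hG h hF _ hG' => hswap V G b u u' w w' hG h hF hG'⟩
  have ⟨v⟩ := hG.1
  exact fun h => (hx v).ne' (congrFun h v)
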